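/- Fix integers $N\ge\tau\ge 2$ and real numbers $0<\alpha\le\beta$. There are $N$ clients; client $i$ holds a differentiable function $f_i:\ell_2\to\mathbb R$, and $F=\sum_{i=1}^N f_i$. Write $f_i^*(y)=\sup_w(\langle y,w\rangle-f_i(w))$. **Random-participation first-order black-box procedure.** The participation sets $\mathcal N_1,\mathcal N_2,\dots$ are independent and uniformly distributed among the $\tau$-element subsets of $\{1,\dots,N\}$. The server memory and the client memories are $\mathcal M_{\mathrm{server},0}=\mathcal M_{i,0}=\{0\}$ at time $0$, and for $t\ge1$ $$\mathcal M_{\mathrm{server},t}=\mathrm{Span}\Big(\mathcal M_{\mathrm{server},t-1}\cup\bigcup_{i\in\mathcal N_t}\mathcal M_{i,t-1}\Big),\qquad \mathcal M_{i,t}=\Big(\bigcup_{k\ge0}\mathcal A^{i,t}_k\Big)\cup\{r_{i,t}\},$$ where $\mathcal A^{i,t}_0=\mathrm{Span}\{w,\nabla f_i(w),\nabla f_i^*(w):w\in\mathcal M_{i,t-1}\}$, $\mathcal A^{i,t}_{k}=\mathrm{Span}\{w,\nabla f_i(w),\nabla f_i^*(w):w\in\mathcal A^{i,t}_{k-1}\}$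 for $k\ge1$, and $r_{i,t}\in\mathcal M_{\mathrm{server},t-1}$ is chosen arbitrarily by the algorithm. The output at time $t$ is a point $w^{(t)}\in\mathcal M_{\mathrm{server},t}$ chosen arbitrarily by the algorithm. The choices of the algorithm may depend on the participation sets and on internal randomness. **Theorem (lower bound).** There is an absolute constant $c>0$ such that for all integers $N\ge\tau\ge2$ and all reals $0<\alpha\le\beta$ there exist functions $f_1,\dots,f_N:\ell_2\to\mathbb R$, each differentiable and satisfying, for all $x,y\in\ell_2$, $$\tfrac{\alpha}{2}\|x-y\|^2\le f_i(x)-f_i(y)-\langle\nabla f_i(y),x-y\rangle\le\tfrac{\beta}{2}\|x-y\|^2,$$ such that $F$ has a minimizer $w^*$ and, for every algorithm of the above procedure and every integer $T\ge1$: 1. $$\mathbb E\big[F(w^{(T)})-F(w^*)\big]\ \ge\ c\,\Big(1-\min\Big\{\frac{\tau}{\sqrt N}\,\frac{4}{\sqrt{\beta/\alpha}},\,1\Big\}\Big)^{T};$$ 2. if moreover $\sqrt N\sqrt{\beta/\alpha}\ge 8\tau$ (that is, $\beta/\alpha$ is large) and $\mathbb E[F(w^{(T)})-F(w^*)]\le\varepsilon$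 for some $0<\varepsilon<1$, then $$T\ \ge\ c\,\frac{\sqrt N}{\tau}\sqrt{\frac{\beta}{\alpha}}\,\ln\frac1\varepsilon .$$ -/

import Mathlib

namespace RandomParticipation

open MeasureTheory ProbabilityTheory

/-- The real Hilbert space of square-summable sequences. -/
abbrev EllTwo : Type := lp (fun _ : ℕ => ℝ) 2

section General

variable {E : Type*} [NormedAddCommGroup E] [InnerProductSpace ℝ E] [CompleteSpace E]

/-- Differentiable `f` with `f x ≥ f y + ⟪∇f(y), x - y⟫ + (α/2) ‖x - y‖²` for all `x, y`. -/
def IsStronglyConvex (α : ℝ) (f : E → ℝ) : Prop :=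
  Differentiable ℝ f ∧
    ∀ x y : E, f y + inner ℝ (gradient f y) (x - y) + α / 2 * ‖x - y‖ ^ 2 ≤ f x

/-- Differentiable `f` with `f x ≤ f y + ⟪∇f(y), x - y⟫ + (β/2) ‖x - y‖²` for all `x, y`. -/
def IsSmooth (β : ℝ) (f : E → ℝ) : Prop :=
  Differentiable ℝ f ∧
    ∀ x y : E, f x ≤ f y + inner ℝ (gradient f y) (x - y) + β / 2 * ‖x - y‖ ^ 2

/-- The convex conjugate `f*(y) = sup_w (⟪y, w⟫ - f w)`. The supremum is finite, and `f*` is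
differentiable, whenever `f` is strongly convex; it is used for such `f` only. -/
noncomputable def conjugate (f : E → ℝ) (y : E) : ℝ := ⨆ w : E, (inner ℝ y w - f w)

/-- `Span {w, ∇f(w), ∇f*(w) : w ∈ M}`. -/
noncomputable def oracleSpan (f : E → ℝ) (M : Set E) : Submodule ℝ E :=
  Submodule.span ℝ (M ∪ gradient f '' M ∪ gradient (conjugate f) '' M)

/-- The spaces `A 0 = oracleSpan f M` and `A (k + 1) = oracleSpan f (A k)`. -/
noncomputable def oracleIterate (f : E → ℝ) (M : Set E) : ℕ → Submodule ℝ E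
  | 0 => oracleSpan f M
  | k + 1 => oracleSpan f (oracleIterate f M k : Set E)

/-- Everything a client with objective `f` and memory `M` may compute locally, with arbitrarily
many oracle calls: the union of the spaces `A k`. -/
noncomputable def localComputation (f : E → ℝ) (M : Set E) : Set E :=
  ⋃ k : ℕ, (oracleIterate f M k : Set E)

/-- The memories of the server and of the `N` clients at one time. -/
structure Memory (N : ℕ) (E : Type*) where
  server : Set E
  client : Fin N → Set E

/-- The memories at time `t`, when `S t` is the set of clients participating in round `t` and
`recv t i` is the model that client `i` receives from the server in round `t`. All memories
are `{0}` at time `0`. -/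
noncomputable def memory {N : ℕ} (f : Fin N → E → ℝ) (S : ℕ → Finset (Fin N))
    (recv : ℕ → Fin N → E) : ℕ → Memory N E
  | 0 => { server := {0}, client := fun _ => {0} }
  | t + 1 =>
    { server := (Submodule.span ℝ ((memory f S recv t).server ∪
        ⋃ i ∈ S (t + 1), (memory f S recv t).client i) : Set E)
      client := fun i =>
        localComputation (f i) ((memory f S recv t).client i) ∪ {recv (t + 1) i} }

/-- `S 1, S 2, …` are independent and each is uniformly distributed among the subsets of
cardinality `τ` of the set of clients. -/
structure IsUniformParticipation {Ω : Type*} [MeasurableSpace Ω] (P : Measure Ω) {N : ℕ}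
    (τ : ℕ) (S : ℕ → Ω → Finset (Fin N)) : Prop where
  measurable : ∀ t, Measurable[_, ⊤] (S t)
  indep : iIndepFun (m := fun _ => ⊤) S P
  uniform : ∀ (t : ℕ) (s : Finset (Fin N)), s.card = τ →
    P {ω | S t ω = s} = ((N.choose τ : ℕ) : ENNReal)⁻¹

/-- An execution of the random-participation first-order black-box procedure. In round `t + 1`
client `i` receives an arbitrary model `recv (t + 1) i` of the server memory at time `t`, and
`w t` is an arbitrary model of the server memory at time `t`. These choices may depend in any
way on the outcome `ω`, hence on the participation sets and on internal randomness. -/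
structure IsBlackBoxProcedure {Ω : Type*} [MeasurableSpace Ω] (P : Measure Ω) {N : ℕ} (τ : ℕ)
    (f : Fin N → E → ℝ) (S : ℕ → Ω → Finset (Fin N)) (recv : ℕ → Fin N → Ω → E)
    (w : ℕ → Ω → E) : Prop where
  participation : IsUniformParticipation P τ S
  recv_mem : ∀ ω t i, recv (t + 1) i ω ∈
    (memory f (fun s => S s ω) (fun s j => recv s j ω) t).server
  output_mem : ∀ ω t, w t ω ∈
    (memory f (fun s => S s ω) (fun s j => recv s j ω) t).server

/-- The expectation, in `[0, ∞]`, of `F(w) - F(wstar)` with `F = ∑ i, f i`, for a random point `w`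
and a minimizer `wstar` of `F`. -/
noncomputable def expectedSuboptimality {Ω : Type*} [MeasurableSpace Ω] (P : Measure Ω) {N : ℕ}
    (f : Fin N → E → ℝ) (wstar : E) (w : Ω → E) : ENNReal :=
  ∫⁻ ω, ENNReal.ofReal ((∑ i, f i (w ω)) - ∑ i, f i wstar) ∂P

end General

end RandomParticipation

/-!
The lower bound comes from a quadratic chain in `ℓ²` whose links alternate between two of the
clients; every other client holds `(α/2) ‖x‖²`.

Let `γ = β - α`. Client `a` holds the links `(1, 2), (3, 4), …` together with a linear term along
`e_0`, and client `b` holds the links `(0, 1), (2, 3), …`. The links of one client are disjoint, so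
its Hessian is `α + γ P` with `P` a symmetric projection (`pairProjection`), and its objective is
`α`-strongly convex and `β`-smooth. The inverse of this Hessian is again a combination of the
identity and `P`; hence arbitrarily many evaluations of `∇f` and of `∇f*` stay inside every
`P`-invariant subspace containing the linear term (`oracleSpan_quadraticObjective_le`). If only the
first `K` coordinates have been discovered, then one particular client can discover the next one,
and it can discover no more than that one. The server learns the new coordinate only when this
client participates (`memory_subset`).

The client that is awaited is determined by the past, so in each round the number `K` of discovered
coordinates grows by one with conditional probability at most `τ / N`. Therefore
`𝔼 r ^ K ≥ (1 - (τ / N) (1 - r)) ^ T` for `0 ≤ r ≤ 1` (`le_lintegral_pow_progress`).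

The minimizer of the sum is the geometric sequence `D ρ ^ n`, where `ρ = (√κ' - 1) / (√κ' + 1)` and
`κ' = 1 + 2γ / (Nα)` (`sum_gradient_geometricSeq_eq_zero`). A point that misses the coordinates from
`K` on has suboptimality at least `(Nα/2) D² ρ ^ (2K)`, and the linear term is scaled so that
`(Nα/2) D² = 1`. Taking `r = ρ²` gives the first claim, because
`(τ / N) (1 - ρ²) ≤ 4τ / (√N √(β/α))` (`exists_ratio`). The second claim follows by taking
logarithms (`log_le_of_one_sub_pow_le`).
-/

namespace RandomParticipation

open MeasureTheory ProbabilityTheory Filter Topology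

/-! ### Quadratic objectives built from a symmetric projection -/

section Quadratic

variable {E : Type*} [NormedAddCommGroup E] [InnerProductSpace ℝ E]

/-- The quadratic `x ↦ (α/2) ‖x‖² + (γ/2) ‖P x‖² - ⟪b, x⟫`. When `P` is a symmetric projection,
its Hessian is `α + γ P`, with the eigenvalues `α` and `α + γ`. -/
noncomputable def quadraticObjective (α γ : ℝ) (P : E →ₗ[ℝ] E) (b x : E) : ℝ :=
  α / 2 * ‖x‖ ^ 2 + γ / 2 * ‖P x‖ ^ 2 - inner ℝ b x

/-- The solution `z` of `α z + γ P z - b = y` for a symmetric projection `P`: the gradient at `y`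
of the conjugate of `quadraticObjective α γ P b`. -/
noncomputable def dualPoint (α γ : ℝ) (P : E →ₗ[ℝ] E) (b y : E) : E :=
  α⁻¹ • (y + b) + ((α + γ)⁻¹ - α⁻¹) • P (y + b)

theorem _root_.LinearMap.IsSymmetricProjection.norm_sq_map {P : E →ₗ[ℝ] E}
    (hP : P.IsSymmetricProjection) (x : E) :
    ‖P x‖ ^ 2 = inner ℝ (P x) x := by
  have h : P (P x) = P x := LinearMap.congr_fun hP.isIdempotentElem x
  rw [← real_inner_self_eq_norm_sq, ← hP.isSymmetric, h]

theorem _root_.LinearMap.IsSymmetricProjection.norm_sq_map_le {P : E →ₗ[ℝ] E}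
    (hP : P.IsSymmetricProjection) (x : E) : ‖P x‖ ^ 2 ≤ ‖x‖ ^ 2 := by
  have h1 := hP.norm_sq_map x
  have h2 := real_inner_le_norm (P x) x
  nlinarith [sq_nonneg (‖P x‖ - ‖x‖)]

/-- The exact second-order expansion of the quadratic around `y`. -/
theorem quadraticObjective_expansion (α γ : ℝ) {P : E →ₗ[ℝ] E} (hP : P.IsSymmetricProjection)
    (b x y : E) :
    quadraticObjective α γ P b x = quadraticObjective α γ P b y
      + inner ℝ (α • y + γ • P y - b) (x - y) + α / 2 * ‖x - y‖ ^ 2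
      + γ / 2 * ‖P (x - y)‖ ^ 2 := by
  obtain ⟨h, rfl⟩ : ∃ h, x = y + h := ⟨x - y, by abel⟩
  have h1 : P (P y) = P y := LinearMap.congr_fun hP.isIdempotentElem y
  have h2 : inner ℝ (P y) (P h) = inner ℝ (P y) h := by rw [← hP.isSymmetric, h1]
  simp only [quadraticObjective, add_sub_cancel_left, map_add, norm_add_sq_real, inner_sub_left,
    inner_add_left, inner_add_right, real_inner_smul_left, h2]
  ring

theorem gradient_at_dualPoint {α γ : ℝ} (hα : 0 < α) (hγ : 0 ≤ γ) {P : E →ₗ[ℝ] E}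
    (hP : P.IsSymmetricProjection) (b y : E) :
    α • dualPoint α γ P b y + γ • P (dualPoint α γ P b y) - b = y := by
  have h1 : P (P (y + b)) = P (y + b) := LinearMap.congr_fun hP.isIdempotentElem _
  have hα' : α ≠ 0 := hα.ne'
  have hβ' : α + γ ≠ 0 := by positivity
  have h2 : α * ((α + γ)⁻¹ - α⁻¹) + γ * (α + γ)⁻¹ = 0 := by field_simp; ring
  have h3 : P (dualPoint α γ P b y) = (α + γ)⁻¹ • P (y + b) := by
    simp only [dualPoint, map_add P (α⁻¹ • (y + b)), map_smul, h1, ← add_smul]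
    congr 1; ring
  rw [h3, dualPoint, smul_add, smul_smul, smul_smul, smul_smul, mul_inv_cancel₀ hα', one_smul,
    add_assoc, ← add_smul, h2, zero_smul]
  abel

theorem conjugate_quadraticObjective {α γ : ℝ} (hα : 0 < α) (hγ : 0 ≤ γ) {P : E →ₗ[ℝ] E}
    (hP : P.IsSymmetricProjection) (b y : E) :
    IsGreatest (Set.range fun w => inner ℝ y w - quadraticObjective α γ P b w)
      (conjugate (quadraticObjective α γ P b) y) ∧
    conjugate (quadraticObjective α γ P b) y =
      inner ℝ y (dualPoint α γ P b y) - quadraticObjective α γ P b (dualPoint α γ P b y) := by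
  have h : IsGreatest (Set.range fun w => inner ℝ y w - quadraticObjective α γ P b w)
      (inner ℝ y (dualPoint α γ P b y)
        - quadraticObjective α γ P b (dualPoint α γ P b y)) := by
    refine ⟨⟨_, rfl⟩, ?_⟩
    rintro _ ⟨w, rfl⟩
    have h1 := quadraticObjective_expansion α γ hP b w (dualPoint α γ P b y)
    rw [gradient_at_dualPoint hα hγ hP, inner_sub_right] at h1
    have h2 : 0 ≤ γ / 2 * ‖P (w - dualPoint α γ P b y)‖ ^ 2 := by positivity
    have h3 : 0 ≤ α / 2 * ‖w - dualPoint α γ P b y‖ ^ 2 := by positivity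
    simp only
    linarith
  have h' : conjugate (quadraticObjective α γ P b) y = _ := h.csSup_eq
  exact ⟨h' ▸ h, h'⟩

/-- A first-order expansion with a quadratic error determines the gradient. -/
theorem hasGradientAt_of_quadratic_bound [CompleteSpace E] {f : E → ℝ} {g y : E} {C : ℝ}
    (h : ∀ x, |f x - f y - inner ℝ g (x - y)| ≤ C * ‖x - y‖ ^ 2) : HasGradientAt f g y := by
  rw [hasGradientAt_iff_isLittleO]
  exact (Asymptotics.IsBigO.of_bound C (Eventually.of_forall fun x => by
    simpa using h x)).trans_isLittleO (Asymptotics.isLittleO_pow_sub_sub y one_lt_two)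

variable [CompleteSpace E]

theorem hasGradientAt_quadraticObjective {α γ : ℝ} (hα : 0 ≤ α) (hγ : 0 ≤ γ) {P : E →ₗ[ℝ] E}
    (hP : P.IsSymmetricProjection) (b y : E) :
    HasGradientAt (quadraticObjective α γ P b) (α • y + γ • P y - b) y := by
  refine hasGradientAt_of_quadratic_bound (C := (α + γ) / 2) fun x => ?_
  have h1 := quadraticObjective_expansion α γ hP b x y
  have h2 := hP.norm_sq_map_le (x - y)
  have h3 : 0 ≤ ‖x - y‖ ^ 2 := by positivity
  have h4 : 0 ≤ ‖P (x - y)‖ ^ 2 := by positivity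
  rw [abs_le]
  constructor <;> nlinarith

theorem gradient_quadraticObjective {α γ : ℝ} (hα : 0 ≤ α) (hγ : 0 ≤ γ) {P : E →ₗ[ℝ] E}
    (hP : P.IsSymmetricProjection) (b y : E) :
    gradient (quadraticObjective α γ P b) y = α • y + γ • P y - b :=
  (hasGradientAt_quadraticObjective hα hγ hP b y).gradient

theorem isStronglyConvex_quadraticObjective {α γ : ℝ} (hα : 0 ≤ α) (hγ : 0 ≤ γ) {P : E →ₗ[ℝ] E}
    (hP : P.IsSymmetricProjection) (b : E) :
    IsStronglyConvex α (quadraticObjective α γ P b) := by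
  refine ⟨fun y => (hasGradientAt_quadraticObjective hα hγ hP b y).differentiableAt,
    fun x y => ?_⟩
  rw [gradient_quadraticObjective hα hγ hP, quadraticObjective_expansion α γ hP b x y]
  have : 0 ≤ γ / 2 * ‖P (x - y)‖ ^ 2 := by positivity
  linarith

theorem isSmooth_quadraticObjective {α γ : ℝ} (hα : 0 ≤ α) (hγ : 0 ≤ γ) {P : E →ₗ[ℝ] E}
    (hP : P.IsSymmetricProjection) (b : E) :
    IsSmooth (α + γ) (quadraticObjective α γ P b) := by
  refine ⟨fun y => (hasGradientAt_quadraticObjective hα hγ hP b y).differentiableAt,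
    fun x y => ?_⟩
  rw [gradient_quadraticObjective hα hγ hP, quadraticObjective_expansion α γ hP b x y]
  have := hP.norm_sq_map_le (x - y)
  nlinarith

/-- The maximizer `z` in the conjugate at `y` is a subgradient of the conjugate there, and it
depends on `y` in a Lipschitz way; comparing the subgradient inequalities at two points shows that
it is the gradient. -/
theorem gradient_conjugate_quadraticObjective {α γ : ℝ} (hα : 0 < α) (hγ : 0 ≤ γ)
    {P : E →ₗ[ℝ] E} (hP : P.IsSymmetricProjection) (b y : E) :
    gradient (conjugate (quadraticObjective α γ P b)) y = dualPoint α γ P b y := by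
  refine HasGradientAt.gradient (hasGradientAt_of_quadratic_bound (C := α⁻¹) fun x => ?_)
  obtain ⟨hx, hx'⟩ := conjugate_quadraticObjective hα hγ hP b x
  obtain ⟨hy, hy'⟩ := conjugate_quadraticObjective hα hγ hP b y
  have h1 := hx.2 ⟨dualPoint α γ P b y, rfl⟩
  have h2 := hy.2 ⟨dualPoint α γ P b x, rfl⟩
  simp only at h1 h2
  have h3 : inner ℝ (dualPoint α γ P b x - dualPoint α γ P b y) (x - y)
      ≤ α⁻¹ * ‖x - y‖ ^ 2 := by
    have e : dualPoint α γ P b x - dualPoint α γ P b y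
        = α⁻¹ • (x - y) + ((α + γ)⁻¹ - α⁻¹) • P (x - y) := by
      simp only [dualPoint, map_add, map_sub, smul_add, smul_sub]; abel
    rw [e, inner_add_left, real_inner_smul_left, real_inner_smul_left,
      real_inner_self_eq_norm_sq, ← hP.norm_sq_map]
    have : (α + γ)⁻¹ - α⁻¹ ≤ 0 := sub_nonpos.2 (inv_anti₀ hα (by linarith))
    nlinarith [sq_nonneg ‖P (x - y)‖]
  simp only [inner_sub_right, real_inner_comm x, real_inner_comm y] at *
  rw [abs_le]
  constructor <;> linarith

/-- Local computation cannot leave a subspace that contains `b` and is invariant under `P`, not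
even with the gradients of the conjugate. -/
theorem oracleSpan_quadraticObjective_le {α γ : ℝ} (hα : 0 < α) (hγ : 0 ≤ γ) {P : E →ₗ[ℝ] E}
    (hP : P.IsSymmetricProjection) {b : E} {V : Submodule ℝ E} (hb : b ∈ V)
    (hV : ∀ x ∈ V, P x ∈ V) :
    oracleSpan (quadraticObjective α γ P b) (V : Set E) ≤ V := by
  refine Submodule.span_le.2 (Set.union_subset (Set.union_subset subset_rfl ?_) ?_)
  · rintro _ ⟨x, hx, rfl⟩
    rw [gradient_quadraticObjective hα.le hγ hP]
    exact V.sub_mem (V.add_mem (V.smul_mem _ hx) (V.smul_mem _ (hV x hx))) hb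
  · rintro _ ⟨x, hx, rfl⟩
    rw [gradient_conjugate_quadraticObjective hα hγ hP]
    have hxb := V.add_mem hx hb
    exact V.add_mem (V.smul_mem _ hxb) (V.smul_mem _ (hV _ hxb))

end Quadratic

/-! ### How far the memories can have advanced -/

section Progress

variable {E : Type*} [NormedAddCommGroup E] [InnerProductSpace ℝ E] [CompleteSpace E] {N : ℕ}

theorem oracleSpan_mono (f : E → ℝ) {M M' : Set E} (h : M ⊆ M') :
    oracleSpan f M ≤ oracleSpan f M' :=
  Submodule.span_mono (Set.union_subset_union (Set.union_subset_union h (Set.image_mono h))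
    (Set.image_mono h))

theorem localComputation_subset {f : E → ℝ} {V : Submodule ℝ E}
    (hV : oracleSpan f (V : Set E) ≤ V) {M : Set E} (hM : M ⊆ V) :
    localComputation f M ⊆ V := by
  refine Set.iUnion_subset fun k => ?_
  change oracleIterate f M k ≤ V
  induction k with
  | zero => exact (oracleSpan_mono f hM).trans hV
  | succ k ih => exact (oracleSpan_mono f ih).trans hV

/-- The number of stages completed after `t` rounds. With `K` stages completed, the following stage
is completed in the next round in which the client `next K` participates. -/
def progress (next : ℕ → Fin N) (S : ℕ → Finset (Fin N)) : ℕ → ℕ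
  | 0 => 0
  | t + 1 => progress next S t + if next (progress next S t) ∈ S (t + 1) then 1 else 0

/-- Let `V 0 ≤ V 1 ≤ …` be subspaces such that only the client `next K` can compute its way out of
`V K`, and suppose that consecutive values of `next` differ. With `K` stages completed the server
memory lies in `V K`; so do the client memories, except that of `next K`, which may extend to
`V (K + 1)`. -/
theorem memory_subset {f : Fin N → E → ℝ} {V : ℕ → Submodule ℝ E} (hV : Monotone V)
    {next : ℕ → Fin N} (hnext : ∀ K, next (K + 1) ≠ next K)
    (hclosed : ∀ K i, i ≠ next K → oracleSpan (f i) (V K : Set E) ≤ V K)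
    {S : ℕ → Finset (Fin N)} {recv : ℕ → Fin N → E}
    (hrecv : ∀ t i, recv (t + 1) i ∈ (memory f S recv t).server) (t : ℕ) :
    (memory f S recv t).server ⊆ V (progress next S t) ∧
    (∀ i, i ≠ next (progress next S t) →
      (memory f S recv t).client i ⊆ V (progress next S t)) ∧
    ∀ i, (memory f S recv t).client i ⊆ V (progress next S t + 1) := by
  induction t with
  | zero => simp [memory]
  | succ t ih =>
    obtain ⟨hs, hc, hc'⟩ := ih
    set K := progress next S t with hK
    have hV1 : (V K : Set E) ⊆ V (K + 1) := hV K.le_succ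
    have hV2 : (V (K + 1) : Set E) ⊆ V (K + 2) := hV (K + 1).le_succ
    have hc1 : ∀ i, i ≠ next K → (memory f S recv (t + 1)).client i ⊆ V K := fun i hi =>
      Set.union_subset (localComputation_subset (hclosed K i hi) (hc i hi))
        (Set.singleton_subset_iff.2 (hs (hrecv t i)))
    have hc2 : ∀ i, (memory f S recv (t + 1)).client i ⊆ V (K + 1) := fun i => by
      by_cases hi : i = next K
      · refine Set.union_subset (localComputation_subset (hclosed (K + 1) i ?_) (hc' i))
          (Set.singleton_subset_iff.2 (hV1 (hs (hrecv t i))))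
        exact hi ▸ (hnext K).symm
      · exact (hc1 i hi).trans hV1
    by_cases hmem : next K ∈ S (t + 1)
    · have e : progress next S (t + 1) = K + 1 := by simp [progress, ← hK, hmem]
      rw [e]
      refine ⟨?_, fun i _ => hc2 i, fun i => (hc2 i).trans hV2⟩
      exact Submodule.span_le.2 (Set.union_subset (hs.trans hV1)
        (Set.iUnion₂_subset fun i _ => hc' i))
    · have e : progress next S (t + 1) = K := by simp [progress, ← hK, hmem]
      rw [e]
      refine ⟨?_, hc1, hc2⟩
      exact Submodule.span_le.2 (Set.union_subset hs
        (Set.iUnion₂_subset fun i hi => hc i fun h => hmem (h ▸ hi)))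

end Progress

/-! ### Random participation -/

section Participation

variable {Ω : Type*} {N τ : ℕ} {S : ℕ → Ω → Finset (Fin N)}

theorem measurable_progress (next : ℕ → Fin N) (S : ℕ → Ω → Finset (Fin N)) (t : ℕ) :
    Measurable[⨆ u ∈ Set.Iic t, MeasurableSpace.comap (S u) ⊤]
      fun ω => progress next (fun s => S s ω) t := by
  let _ : MeasurableSpace (Finset (Fin N)) := ⊤
  have _ : DiscreteMeasurableSpace (Finset (Fin N)) := ⟨fun _ => trivial⟩
  have key : ∀ t' ≤ t, Measurable[⨆ u ∈ Set.Iic t, MeasurableSpace.comap (S u) ⊤]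
      fun ω => progress next (fun s => S s ω) t' := by
    intro t' ht'
    induction t' with
    | zero => exact measurable_const
    | succ t' ih =>
      have h1 := ih (by omega)
      have h2 : Measurable[⨆ u ∈ Set.Iic t, MeasurableSpace.comap (S u) ⊤] (S (t' + 1)) :=
        Measurable.mono (comap_measurable (S (t' + 1)))
          (le_iSup₂_of_le (t' + 1) ht' le_rfl) le_rfl
      have h3 : Measurable
          fun p : ℕ × Finset (Fin N) => p.1 + if next p.1 ∈ p.2 then 1 else 0 :=
        measurable_of_countable _
      exact h3.comp (h1.prodMk h2)
  exact key t le_rfl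

variable [mΩ : MeasurableSpace Ω] {P : Measure Ω}

theorem IsUniformParticipation.measurableSet (h : IsUniformParticipation P τ S) (t : ℕ)
    (A : Set (Finset (Fin N))) : MeasurableSet (S t ⁻¹' A) :=
  h.measurable t (show MeasurableSet[⊤] A from trivial)

variable [IsProbabilityMeasure P]

/-- A given client participates in a given round with probability at most `τ / N`. -/
theorem IsUniformParticipation.measureReal_mem_le (h : IsUniformParticipation P τ S) (hτ : τ ≤ N)
    (t : ℕ) (i : Fin N) : P.real {ω | i ∈ S t ω} ≤ τ / N := by
  obtain ⟨n, rfl⟩ : ∃ n, N = n + 1 := ⟨N - 1, by have := i.pos; omega⟩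
  -- The `τ`-element sets that avoid `i` already carry the mass `1 - τ / N`.
  have h1 : ∑ s ∈ ((Finset.univ.erase i).powersetCard τ), P.real {ω | S t ω = s}
      ≤ P.real {ω | i ∈ S t ω}ᶜ := by
    rw [← measureReal_biUnion_finset (f := fun s => {ω | S t ω = s})
      (fun s _ s' _ hs => Set.disjoint_left.2 fun ω h1 h2 => hs (h1.symm.trans h2))
      fun s _ => h.measurableSet t {s}]
    refine measureReal_mono (Set.iUnion₂_subset fun s hs ω (hω : S t ω = s) hi => ?_)
    have := (Finset.mem_powersetCard.1 hs).1 (hω ▸ hi : i ∈ s)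
    simp at this
  have h2 : ∀ s ∈ ((Finset.univ.erase i).powersetCard τ),
      P.real {ω | S t ω = s} = (((n + 1).choose τ : ℕ) : ℝ)⁻¹ := fun s hs => by
    rw [measureReal_def, h.uniform t s (Finset.mem_powersetCard.1 hs).2]
    simp
  rw [Finset.sum_congr rfl h2, Finset.sum_const, Finset.card_powersetCard,
    probReal_compl_eq_one_sub (s := {ω | i ∈ S t ω}) (h.measurableSet t {s | i ∈ s}),
    Finset.card_erase_of_mem (Finset.mem_univ i), Finset.card_univ, Fintype.card_fin,
    Nat.add_sub_cancel, nsmul_eq_mul] at h1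
  have h3 : ((n.choose τ : ℕ) : ℝ) * (n + 1) = ((n + 1).choose τ : ℕ) * (n + 1 - τ) := by
    have := Nat.choose_mul_succ_eq n τ
    rw [← Nat.cast_inj (R := ℝ)] at this
    push_cast [Nat.cast_sub hτ] at this
    exact this
  have h4 : (0 : ℝ) < ((n + 1).choose τ : ℕ) := by exact_mod_cast Nat.choose_pos hτ
  have h5 : ((n.choose τ : ℕ) : ℝ) * (((n + 1).choose τ : ℕ) : ℝ)⁻¹ = 1 - τ / (n + 1) := by
    field_simp
    linarith
  rw [h5] at h1
  push_cast
  linarith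

/-- A factor `r` paid only if client `i` participates costs at most `1 - (τ / N) (1 - r)` on
average. -/
theorem IsUniformParticipation.le_lintegral_ite (h : IsUniformParticipation P τ S) (hτ : τ ≤ N)
    (t : ℕ) (i : Fin N) {r : ℝ} (hr0 : 0 ≤ r) (hr1 : r ≤ 1) :
    ENNReal.ofReal (1 - τ / N * (1 - r))
      ≤ ∫⁻ ω, ENNReal.ofReal (if i ∈ S t ω then r else 1) ∂P := by
  have hm : MeasurableSet {ω | i ∈ S t ω} := h.measurableSet t {s | i ∈ s}
  have e : (fun ω => if i ∈ S t ω then r else 1)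
      = fun ω => 1 - {ω | i ∈ S t ω}.indicator (fun _ => 1 - r) ω := by
    funext ω
    by_cases hi : i ∈ S t ω <;> simp [hi]
  have hi : Integrable ({ω | i ∈ S t ω}.indicator fun _ => 1 - r) P :=
    (integrable_const _).indicator hm
  rw [← ofReal_integral_eq_lintegral_ofReal, e, integral_sub (integrable_const _) hi,
    integral_indicator_const _ hm]
  · have := h.measureReal_mem_le hτ t i
    refine ENNReal.ofReal_le_ofReal ?_
    simp only [integral_const, probReal_univ, smul_eq_mul, one_mul]
    nlinarith
  · rw [e]
    exact (integrable_const _).sub hi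
  · exact Eventually.of_forall fun ω => by dsimp only; split_ifs <;> simp [hr0]

/-- Each round multiplies the expectation of `r ^ progress` by at least `1 - (τ / N) (1 - r)`: the
client whose participation would complete the current stage is determined by the earlier rounds,
and so is independent of the current participation set. -/
theorem le_lintegral_pow_progress (h : IsUniformParticipation P τ S) (hτ : τ ≤ N)
    (next : ℕ → Fin N) {r : ℝ} (hr0 : 0 ≤ r) (hr1 : r ≤ 1) (T : ℕ) :
    ENNReal.ofReal ((1 - τ / N * (1 - r)) ^ T)
      ≤ ∫⁻ ω, ENNReal.ofReal (r ^ progress next (fun s => S s ω) T) ∂P := by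
  classical
  have hτN : (τ : ℝ) / N ≤ 1 := div_le_one_of_le₀ (by exact_mod_cast hτ) (by positivity)
  have hτN0 : (0 : ℝ) ≤ τ / N := by positivity
  have hq : 0 ≤ 1 - (τ : ℝ) / N * (1 - r) := by nlinarith
  induction T with
  | zero => simp [progress]
  | succ T ih =>
    set K : Ω → ℕ := fun ω => progress next (fun s => S s ω) T with hK
    have hle : ∀ u, MeasurableSpace.comap (S u) ⊤ ≤ mΩ := fun u => (h.measurable u).comap_le
    have hind := indep_iSup_of_disjoint hle h.indep
      (Set.disjoint_singleton_right.2 (by simp : T + 1 ∉ Set.Iic T))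
    have hKm := measurable_progress next S T
    have hSm : Measurable[⨆ u ∈ ({T + 1} : Set ℕ), MeasurableSpace.comap (S u) ⊤, ⊤] (S (T + 1)) :=
      Measurable.mono (ma := .comap (S (T + 1)) ⊤) (mb := ⊤) (fun s hs => ⟨s, hs, rfl⟩)
        (le_iSup₂_of_le (T + 1) rfl le_rfl) le_rfl
    have hpast := iSup₂_le fun u (_ : u ∈ Set.Iic T) => hle u
    have hnow := iSup₂_le fun u (_ : u ∈ ({T + 1} : Set ℕ)) => hle u
    generalize (⨆ u ∈ Set.Iic T, MeasurableSpace.comap (S u) ⊤) = past at hind hKm hpast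
    generalize (⨆ u ∈ ({T + 1} : Set ℕ), MeasurableSpace.comap (S u) ⊤) = now at hind hSm hnow
    let G : Fin N → ℕ → ENNReal := fun i k => if next k = i then ENNReal.ofReal (r ^ k) else 0
    let H : Fin N → Finset (Fin N) → ENNReal := fun i s => ENNReal.ofReal (if i ∈ s then r else 1)
    have hG : ∀ i, Measurable[past] fun ω => G i (K ω) := fun i =>
      (measurable_of_countable (G i)).comp hKm
    have hH : ∀ i, Measurable[now] fun ω => H i (S (T + 1) ω) := fun i s _ =>
      hSm (t := H i ⁻¹' s) trivial
    have hsplit : ∀ ω, ENNReal.ofReal (r ^ progress next (fun s => S s ω) (T + 1))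
        = ∑ i, G i (K ω) * H i (S (T + 1) ω) := fun ω => by
      rw [Finset.sum_eq_single (next (K ω)) (fun i _ hi => by simp [G, hi.symm]) (by simp)]
      simp only [G, H, if_true, ← ENNReal.ofReal_mul (pow_nonneg hr0 (K ω))]
      change ENNReal.ofReal (r ^ (K ω + if next (K ω) ∈ S (T + 1) ω then 1 else 0)) = _
      split_ifs <;> simp only [pow_succ, add_zero, mul_one]
    have hG' : ∀ i, Measurable[mΩ] fun ω => G i (K ω) := fun i => (hG i).mono hpast le_rfl
    have hH' : ∀ i, Measurable[mΩ] fun ω => H i (S (T + 1) ω) := fun i =>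
      (hH i).mono hnow le_rfl
    have hGH : ∀ i, ∫⁻ ω, G i (K ω) * H i (S (T + 1) ω) ∂P
        = (∫⁻ ω, G i (K ω) ∂P) * ∫⁻ ω, H i (S (T + 1) ω) ∂P := fun i =>
      lintegral_mul_eq_lintegral_mul_lintegral_of_independent_measurableSpace hpast hnow hind
        (hG i) (hH i)
    -- From here on `mΩ` has to be the only `σ`-algebra on `Ω` that instance search can find.
    clear hind hpast hnow hG hH hSm hKm
    clear now past
    have hsum : ∀ ω, ENNReal.ofReal (r ^ K ω) = ∑ i, G i (K ω) := fun ω => by simp [G]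
    calc ENNReal.ofReal ((1 - τ / N * (1 - r)) ^ (T + 1))
        = ENNReal.ofReal ((1 - τ / N * (1 - r)) ^ T) * ENNReal.ofReal (1 - τ / N * (1 - r)) := by
          rw [pow_succ, ENNReal.ofReal_mul (pow_nonneg hq T)]
      _ ≤ (∫⁻ ω, ∑ i, G i (K ω) ∂P) * ENNReal.ofReal (1 - τ / N * (1 - r)) := by
          simp only [← hsum]
          gcongr
      _ = ∑ i, (∫⁻ ω, G i (K ω) ∂P) * ENNReal.ofReal (1 - τ / N * (1 - r)) := by
          rw [lintegral_finsetSum _ fun i _ => hG' i, Finset.sum_mul]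
      _ ≤ ∑ i, (∫⁻ ω, G i (K ω) ∂P) * ∫⁻ ω, H i (S (T + 1) ω) ∂P := by
          gcongr with i
          exact h.le_lintegral_ite hτ (T + 1) i hr0 hr1
      _ = ∑ i, ∫⁻ ω, G i (K ω) * H i (S (T + 1) ω) ∂P := by simp only [hGH]
      _ = ∫⁻ ω, ENNReal.ofReal (r ^ progress next (fun s => S s ω) (T + 1)) ∂P := by
          simp only [hsplit]
          rw [lintegral_finsetSum _ fun i _ => by exact (hG' i).mul (hH' i)]

end Participation

/-! ### The chain in `ℓ²` -/

section Chain

/-- The operator on `ℓ²` that permutes the coordinates by `e`. -/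
noncomputable def permute (e : Equiv.Perm ℕ) : EllTwo →ₗ[ℝ] EllTwo where
  toFun x := ⟨fun n => x (e n), memℓp_gen
    ((e.summable_iff (f := fun n => ‖x n‖ ^ (2 : ENNReal).toReal)).2
      ((memℓp_gen_iff (by norm_num)).1 (lp.memℓp x)))⟩
  map_add' _ _ := rfl
  map_smul' _ _ := rfl

theorem permute_apply (e : Equiv.Perm ℕ) (x : EllTwo) (n : ℕ) : permute e x n = x (e n) := rfl

/-- Half the difference of the identity and a coordinate permutation. If the permutation
interchanges the members of some disjoint pairs, this is the projection onto the closed span of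
the vectors `e_m - e_n`, over these pairs `{m, n}`. -/
noncomputable def pairProjection (e : Equiv.Perm ℕ) : EllTwo →ₗ[ℝ] EllTwo :=
  (1 / 2 : ℝ) • (LinearMap.id - permute e)

theorem pairProjection_apply (e : Equiv.Perm ℕ) (x : EllTwo) (n : ℕ) :
    pairProjection e x n = (x n - x (e n)) / 2 := by
  change (1 / 2 : ℝ) * (x n - x (e n)) = _
  ring

theorem isSymmetricProjection_pairProjection {e : Equiv.Perm ℕ} (he : Function.Involutive e) :
    (pairProjection e).IsSymmetricProjection where
  isIdempotentElem := by
    ext x n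
    simp only [Module.End.mul_apply, pairProjection_apply, he n]
    ring
  isSymmetric x y := by
    have h : inner ℝ (permute e x) y = inner ℝ x (permute e y) := by
      rw [lp.inner_eq_tsum, lp.inner_eq_tsum, ← e.tsum_eq]
      simp only [permute_apply, he _]
    simp only [pairProjection, LinearMap.smul_apply, LinearMap.sub_apply, LinearMap.id_apply,
      real_inner_smul_left, real_inner_smul_right, inner_sub_left, inner_sub_right, h]

/-- The permutation that interchanges `2m + 1` and `2m + 2` for every `m`, and fixes `0`. -/
def oddSwap : Equiv.Perm ℕ :=
  Function.Involutive.toPerm (fun n => if n = 0 then 0 else if n % 2 = 1 then n + 1 else n - 1)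
    fun n => by dsimp only; grind

/-- The permutation that interchanges `2m` and `2m + 1` for every `m`. -/
def evenSwap : Equiv.Perm ℕ :=
  Function.Involutive.toPerm (fun n => if n % 2 = 0 then n + 1 else n - 1)
    fun n => by dsimp only; grind

theorem oddSwap_apply (n : ℕ) :
    oddSwap n = if n = 0 then 0 else if n % 2 = 1 then n + 1 else n - 1 := rfl

theorem evenSwap_apply (n : ℕ) : evenSwap n = if n % 2 = 0 then n + 1 else n - 1 := rfl

/-- The sequences supported on the first `K` coordinates. -/
def supportedBelow (K : ℕ) : Submodule ℝ EllTwo where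
  carrier := {x | ∀ n, K ≤ n → x n = 0}
  zero_mem' := fun _ _ => rfl
  add_mem' {x y} hx hy n hn := by
    change x n + y n = 0
    rw [hx n hn, hy n hn, add_zero]
  smul_mem' c x hx n hn := by
    change c * x n = 0
    rw [hx n hn, mul_zero]

theorem supportedBelow_mono : Monotone supportedBelow :=
  fun _ _ h _ hx n hn => hx n (h.trans hn)

theorem pairProjection_mem_supportedBelow {e : Equiv.Perm ℕ} {K : ℕ}
    (he : ∀ n, K ≤ n → K ≤ e n) {x : EllTwo} (hx : x ∈ supportedBelow K) :
    pairProjection e x ∈ supportedBelow K := fun n hn => by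
  rw [pairProjection_apply, hx n hn, hx _ (he n hn), sub_zero, zero_div]

/-- The geometric sequence `D, D ρ, D ρ², …`, for `|ρ| < 1`. -/
noncomputable def geometricSeq (D ρ : ℝ) (hρ : |ρ| < 1) : EllTwo :=
  ⟨fun n => D * ρ ^ n, memℓp_gen <| by
    have h : Summable fun n : ℕ => D ^ 2 * (ρ ^ 2) ^ n :=
      (summable_geometric_of_lt_one (sq_nonneg ρ)
        ((sq_lt_one_iff_abs_lt_one ρ).2 hρ)).mul_left _
    refine h.congr fun n => ?_
    simp only [ENNReal.toReal_ofNat, Real.rpow_ofNat, Real.norm_eq_abs, sq_abs]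
    ring⟩

theorem geometricSeq_apply (D ρ : ℝ) (hρ : |ρ| < 1) (n : ℕ) :
    geometricSeq D ρ hρ n = D * ρ ^ n := rfl

variable {N : ℕ}

/-- The projection of client `i`: client `a` holds the links `(2m + 1, 2m + 2)` of the chain,
client `b` the links `(2m, 2m + 1)`, and the others none. -/
noncomputable def clientProjection (a b i : Fin N) : EllTwo →ₗ[ℝ] EllTwo :=
  if i = a then pairProjection oddSwap else if i = b then pairProjection evenSwap else 0

/-- The linear term of client `i`: client `a` holds `s e_0`, and the others zero. -/
noncomputable def clientLinear (a : Fin N) (s : ℝ) (i : Fin N) : EllTwo :=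
  if i = a then lp.single 2 0 s else 0

/-- The hard instance: the clients `a` and `b` share a chain, and all others hold `(α/2) ‖x‖²`. -/
noncomputable def chainObjective (α γ s : ℝ) (a b i : Fin N) : EllTwo → ℝ :=
  quadraticObjective α γ (clientProjection a b i) (clientLinear a s i)

theorem isSymmetricProjection_clientProjection (a b i : Fin N) :
    (clientProjection a b i).IsSymmetricProjection := by
  unfold clientProjection
  split_ifs
  · exact isSymmetricProjection_pairProjection (Function.Involutive.toPerm_involutive _)
  · exact isSymmetricProjection_pairProjection (Function.Involutive.toPerm_involutive _)
  · exact ⟨.zero, fun x y => by simp⟩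

/-- With the first `K` coordinates known, only one client can reach the next one: client `a` if
`K` is even, client `b` if `K` is odd. -/
theorem oracleSpan_chainObjective_le {α γ : ℝ} (hα : 0 < α) (hγ : 0 ≤ γ) (s : ℝ) {a b : Fin N}
    (K : ℕ) {i : Fin N} (hi : i ≠ if K % 2 = 0 then a else b) :
    oracleSpan (chainObjective α γ s a b i) (supportedBelow K : Set EllTwo)
      ≤ supportedBelow K := by
  refine oracleSpan_quadraticObjective_le hα hγ (isSymmetricProjection_clientProjection a b i) ?_ ?_
  · unfold clientLinear
    split_ifs with h
    · intro n hn
      have hK : K % 2 ≠ 0 := fun hK => hi (by simp [hK, h])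
      rw [lp.single_apply_ne]
      omega
    · exact zero_mem _
  · intro x hx
    unfold clientProjection
    split_ifs with h h'
    · refine pairProjection_mem_supportedBelow (fun n hn => ?_) hx
      have hK : K % 2 ≠ 0 := fun hK => hi (by simp [hK, h])
      rw [oddSwap_apply]
      split_ifs <;> omega
    · refine pairProjection_mem_supportedBelow (fun n hn => ?_) hx
      have hK : K % 2 = 0 := by
        by_contra hK
        exact hi (by simp [hK, h'])
      rw [evenSwap_apply]
      split_ifs <;> omega
    · exact zero_mem _

/-- The geometric sequence solves the three-term recursion that expresses the vanishing of the
gradient of the sum of the objectives. -/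
theorem sum_gradient_geometricSeq_eq_zero {α γ D ρ s : ℝ} (hρ : |ρ| < 1)
    (hrec : γ * (1 - ρ) ^ 2 = 2 * (N * α) * ρ) (hs : s = D * (N * α + γ / 2 * (1 - ρ)))
    {a b : Fin N} (hab : a ≠ b) :
    ∑ i, (α • geometricSeq D ρ hρ + γ • clientProjection a b i (geometricSeq D ρ hρ)
      - clientLinear a s i) = 0 := by
  set g := geometricSeq D ρ hρ with hg
  have h1 : ∑ i, clientProjection a b i g =
      pairProjection oddSwap g + pairProjection evenSwap g := by
    rw [Fintype.sum_eq_add a b hab fun i hi => by simp [clientProjection, hi.1, hi.2]]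
    simp [clientProjection, hab.symm]
  have h2 : ∑ i, clientLinear a s i = lp.single 2 0 s := by simp [clientLinear]
  rw [Finset.sum_sub_distrib, Finset.sum_add_distrib, ← Finset.smul_sum, ← Finset.smul_sum, h1, h2,
    Finset.sum_const, Finset.card_univ, Fintype.card_fin, ← Nat.cast_smul_eq_nsmul ℝ]
  ext n
  change α * (N * g n) + γ * (pairProjection oddSwap g n + pairProjection evenSwap g n)
    - (lp.single 2 0 s : EllTwo) n = 0
  rw [pairProjection_apply, pairProjection_apply, oddSwap_apply, evenSwap_apply]
  rcases n with _ | n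
  · simp only [hg, geometricSeq_apply, lp.single_apply_self]
    simp
    linarith
  · rw [lp.single_apply_ne _ _ _ n.succ_ne_zero]
    have key : α * (N * g (n + 1)) + γ * (2 * g (n + 1) - g n - g (n + 2)) / 2 = 0 := by
      simp only [hg, geometricSeq_apply, pow_succ]
      linear_combination (-(D * ρ ^ n) / 2) * hrec
    rcases Nat.mod_two_eq_zero_or_one (n + 1) with h | h
    all_goals
      simp only [h, n.succ_ne_zero, if_false, if_true, Nat.add_sub_cancel, zero_ne_one, one_ne_zero]
      linear_combination key

/-- The sum of the objectives grows quadratically around a point where the gradients add up to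
zero. -/
theorem sum_chainObjective_ge {α γ s : ℝ} (hγ : 0 ≤ γ) {a b : Fin N} {z : EllTwo}
    (hz : ∑ i, (α • z + γ • clientProjection a b i z - clientLinear a s i) = 0) (x : EllTwo) :
    ∑ i, chainObjective α γ s a b i z + N * α / 2 * ‖x - z‖ ^ 2
      ≤ ∑ i, chainObjective α γ s a b i x := by
  have h : ∀ i, chainObjective α γ s a b i z
      + inner ℝ (α • z + γ • clientProjection a b i z - clientLinear a s i) (x - z)
      + α / 2 * ‖x - z‖ ^ 2 ≤ chainObjective α γ s a b i x := fun i => by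
    have := quadraticObjective_expansion α γ (isSymmetricProjection_clientProjection a b i)
      (clientLinear a s i) x z
    have h0 : 0 ≤ γ / 2 * ‖clientProjection a b i (x - z)‖ ^ 2 := by positivity
    unfold chainObjective
    linarith
  have h' := Finset.sum_le_sum fun i (_ : i ∈ Finset.univ) => h i
  rw [Finset.sum_add_distrib, Finset.sum_add_distrib, ← sum_inner, hz, inner_zero_left,
    Finset.sum_const, Finset.card_univ, Fintype.card_fin, nsmul_eq_mul] at h'
  linarith

/-- A point supported on the first `K` coordinates misses the coordinate `D ρ ^ K`. -/
theorem sq_le_norm_sub_geometricSeq_sq {D ρ : ℝ} (hρ : |ρ| < 1) {K : ℕ} {x : EllTwo}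
    (hx : x ∈ supportedBelow K) : D ^ 2 * (ρ ^ 2) ^ K ≤ ‖x - geometricSeq D ρ hρ‖ ^ 2 := by
  have h := lp.norm_apply_le_norm (p := 2) (by norm_num) (x - geometricSeq D ρ hρ) K
  have e : (x - geometricSeq D ρ hρ) K = -(D * ρ ^ K) := by
    change x K - D * ρ ^ K = _
    rw [hx K le_rfl, zero_sub]
  rw [e, norm_neg, Real.norm_eq_abs] at h
  calc D ^ 2 * (ρ ^ 2) ^ K = |D * ρ ^ K| ^ 2 := by rw [sq_abs]; ring
    _ ≤ _ := by gcongr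

end Chain

/-! ### Rates -/

/-- The ratio `ρ = (√κ' - 1) / (√κ' + 1)` with `κ' = 1 + 2γ / (Nα)`, the condition number of the
sum of the objectives, solves the recursion of the minimizer. One stage, completed with probability
at most `τ / N` in each round, then costs no more than the claimed rate. -/
theorem exists_ratio {N τ : ℕ} {α β : ℝ} (hN : 0 < N) (hα : 0 < α) (hαβ : α ≤ β) :
    ∃ ρ : ℝ, 0 ≤ ρ ∧ ρ < 1 ∧ (β - α) * (1 - ρ) ^ 2 = 2 * (N * α) * ρ ∧
      (τ : ℝ) / N * (1 - ρ ^ 2) ≤ τ / √N * (4 / √(β / α)) := by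
  have hN' : (1 : ℝ) ≤ N := by exact_mod_cast hN
  have hγ : 0 ≤ β - α := sub_nonneg.2 hαβ
  set k : ℝ := √(1 + 2 * (β - α) / (N * α)) with hk
  have hk2 : k ^ 2 = 1 + 2 * (β - α) / (N * α) := Real.sq_sqrt (by positivity)
  have hk1 : 1 ≤ k := Real.one_le_sqrt.2 (by
    have : 0 ≤ 2 * (β - α) / (N * α) := by positivity
    linarith)
  have hρ : 1 - (k - 1) / (k + 1) = 2 / (k + 1) := by field_simp; ring
  have hρ0 : 0 ≤ (k - 1) / (k + 1) := div_nonneg (by linarith) (by linarith)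
  have hρ1 : (k - 1) / (k + 1) < 1 := by rw [div_lt_one (by linarith)]; linarith
  refine ⟨(k - 1) / (k + 1), hρ0, hρ1, ?_, ?_⟩
  · have h1 : N * α * (k ^ 2 - 1) = 2 * (β - α) := by rw [hk2]; field_simp; ring
    rw [hρ]
    field_simp
    linarith
  · have h1 : 1 - ((k - 1) / (k + 1)) ^ 2 ≤ 4 / (k + 1) := by
      have e : 4 / (k + 1) = 2 * (1 - (k - 1) / (k + 1)) := by rw [hρ]; ring
      rw [e]
      nlinarith
    have h2 : √(β / α) ≤ √N * (k + 1) := by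
      have : β / α ≤ N * (1 + 2 * (β - α) / (N * α)) := by
        have e : N * (1 + 2 * (β - α) / (N * α)) = N + 2 * (β / α) - 2 := by field_simp; ring
        have : 1 ≤ β / α := (one_le_div hα).2 hαβ
        linarith
      calc √(β / α) ≤ √N * k := by
            rw [hk, ← Real.sqrt_mul (by positivity)]
            exact Real.sqrt_le_sqrt this
        _ ≤ √N * (k + 1) := by gcongr; linarith
    have h3 : 0 < √(β / α) := Real.sqrt_pos.2 (div_pos (by linarith) hα)
    have h4 : 0 < √(N : ℝ) := Real.sqrt_pos.2 (by linarith)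
    have h5 : √(N : ℝ) * √N = N := Real.mul_self_sqrt (by linarith)
    calc (τ : ℝ) / N * (1 - ((k - 1) / (k + 1)) ^ 2) ≤ τ / N * (4 / (k + 1)) := by gcongr
      _ = τ / √N * (4 / (√N * (k + 1))) := by
          rw [div_mul_div_comm, div_mul_div_comm, ← mul_assoc, h5]
      _ ≤ τ / √N * (4 / √(β / α)) := by gcongr

/-- A quantity that decays no faster than `(1 - q) ^ T`, for `q ≤ 1 / 2`, needs `T` of order
`ln (1 / ε) / q` to fall to `ε`. -/
theorem log_le_of_one_sub_pow_le {q ε : ℝ} (hq : q ≤ 1 / 2) (hq0 : 0 ≤ q) {T : ℕ}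
    (h : (1 - q) ^ T ≤ ε) : Real.log (1 / ε) ≤ 2 * q * T := by
  have h1 : -Real.log (1 - q) ≤ 2 * q := by
    have h2 := Real.one_sub_inv_le_log_of_pos (show 0 < 1 - q by linarith)
    have h3 : (1 - q)⁻¹ ≤ 1 + 2 * q := by
      rw [inv_le_iff_one_le_mul₀ (by linarith)]
      nlinarith
    linarith
  have h4 := Real.log_le_log (pow_pos (by linarith) T) h
  rw [Real.log_pow] at h4
  rw [one_div, Real.log_inv]
  nlinarith [mul_le_mul_of_nonneg_right h1 (Nat.cast_nonneg (α := ℝ) T)]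

/-! ### The expected suboptimality on the chain -/

/-- The lower bound on the expected suboptimality for the chain, with `D` the first coordinate of
the minimizer. -/
theorem le_expectedSuboptimality_chainObjective {Ω : Type*} [MeasurableSpace Ω] {P : Measure Ω}
    [IsProbabilityMeasure P] {N τ : ℕ} (hτ : τ ≤ N) {α γ s D ρ : ℝ} (hα : 0 < α) (hγ : 0 ≤ γ)
    (hρ : |ρ| < 1) (hD : N * α / 2 * D ^ 2 = 1) {a b : Fin N} (hab : a ≠ b)
    (hz : ∑ i, (α • geometricSeq D ρ hρ + γ • clientProjection a b i (geometricSeq D ρ hρ)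
      - clientLinear a s i) = 0)
    {S : ℕ → Ω → Finset (Fin N)} {recv : ℕ → Fin N → Ω → EllTwo} {w : ℕ → Ω → EllTwo}
    (h : IsBlackBoxProcedure P τ (chainObjective α γ s a b) S recv w) (T : ℕ) :
    ENNReal.ofReal ((1 - τ / N * (1 - ρ ^ 2)) ^ T)
      ≤ expectedSuboptimality P (chainObjective α γ s a b) (geometricSeq D ρ hρ) (w T) := by
  set next : ℕ → Fin N := fun K => if K % 2 = 0 then a else b with hnext
  refine (le_lintegral_pow_progress h.participation hτ next (sq_nonneg ρ)
    ((sq_lt_one_iff_abs_lt_one ρ).2 hρ).le T).trans (lintegral_mono fun ω => ?_)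
  have hsub := (memory_subset supportedBelow_mono (next := next)
    (fun K => by
      rcases Nat.mod_two_eq_zero_or_one K with hK | hK
      · simpa [hnext, hK, Nat.add_mod] using hab.symm
      · simpa [hnext, hK, Nat.add_mod] using hab)
    (fun K i hi => oracleSpan_chainObjective_le hα hγ s K hi)
    (h.recv_mem ω) T).1 (h.output_mem ω T)
  have h1 := sum_chainObjective_ge hγ hz (w T ω)
  have h2 := sq_le_norm_sub_geometricSeq_sq (D := D) hρ hsub
  have h3 : 0 ≤ (N : ℝ) * α / 2 := by positivity
  have h4 := mul_le_mul_of_nonneg_left h2 h3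
  rw [← mul_assoc, hD, one_mul] at h4
  refine ENNReal.ofReal_le_ofReal ?_
  linarith

end RandomParticipation

theorem mainTheorem4 :
    ∃ c : ℝ, 0 < c ∧
      ∀ (N τ : ℕ) (α β : ℝ), 2 ≤ τ → τ ≤ N → 0 < α → α ≤ β →
        ∃ (f : Fin N → RandomParticipation.EllTwo → ℝ) (wstar : RandomParticipation.EllTwo),
          (∀ i, RandomParticipation.IsStronglyConvex α (f i)) ∧
          (∀ i, RandomParticipation.IsSmooth β (f i)) ∧
          (∀ x, ∑ i, f i wstar ≤ ∑ i, f i x) ∧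
          ∀ (Ω : Type*) [MeasurableSpace Ω] (P : MeasureTheory.Measure Ω)
            [MeasureTheory.IsProbabilityMeasure P]
            (S : ℕ → Ω → Finset (Fin N))
            (recv : ℕ → Fin N → Ω → RandomParticipation.EllTwo)
            (w : ℕ → Ω → RandomParticipation.EllTwo),
            RandomParticipation.IsBlackBoxProcedure P τ f S recv w →
            ∀ T : ℕ, 1 ≤ T →
              ENNReal.ofReal
                  (c * (1 - min ((τ : ℝ) / √(N : ℝ) * (4 / √(β / α))) 1) ^ T)
                ≤ RandomParticipation.expectedSuboptimality P f wstar (w T) ∧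
              (8 * (τ : ℝ) ≤ √(N : ℝ) * √(β / α) →
                ∀ ε : ℝ, 0 < ε → ε < 1 →
                  RandomParticipation.expectedSuboptimality P f wstar (w T) ≤ ENNReal.ofReal ε →
                  c * (√(N : ℝ) / (τ : ℝ) * √(β / α) * Real.log (1 / ε)) ≤ (T : ℝ)) := by
  open RandomParticipation in
  refine ⟨1 / 8, by norm_num, fun N τ α β hτ2 hτ hα hαβ => ?_⟩
  have hγ : 0 ≤ β - α := sub_nonneg.2 hαβ
  have hN0 : 0 < N := by omega
  have hN : (0 : ℝ) < N := by exact_mod_cast hN0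
  obtain ⟨ρ, hρ0, hρ1, hrec, hrate⟩ := exists_ratio (τ := τ) hN0 hα hαβ
  have hρ : |ρ| < 1 := by rwa [abs_of_nonneg hρ0]
  let a : Fin N := ⟨0, by omega⟩
  let b : Fin N := ⟨1, by omega⟩
  have hab : a ≠ b := by simp [a, b]
  -- The first coordinate of the minimizer is normalized so that missing it costs at least `1`.
  set D : ℝ := √(2 / (N * α)) with hD
  have hD2 : N * α / 2 * D ^ 2 = 1 := by
    rw [hD, Real.sq_sqrt (by positivity)]
    field_simp
  set s : ℝ := D * (N * α + (β - α) / 2 * (1 - ρ)) with hs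
  have hz := sum_gradient_geometricSeq_eq_zero hρ hrec hs hab
  refine ⟨chainObjective α (β - α) s a b, geometricSeq D ρ hρ, fun i => ?_, fun i => ?_,
    fun x => ?_, ?_⟩
  · exact isStronglyConvex_quadraticObjective hα.le hγ
      (isSymmetricProjection_clientProjection a b i) _
  · have := isSmooth_quadraticObjective hα.le hγ
      (isSymmetricProjection_clientProjection a b i) (clientLinear a s i)
    rwa [add_sub_cancel] at this
  · have h1 := sum_chainObjective_ge hγ hz x
    have h2 : 0 ≤ N * α / 2 * ‖x - geometricSeq D ρ hρ‖ ^ 2 := by positivity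
    linarith
  · intro Ω _ P _ S recv w h T _
    have hbound := le_expectedSuboptimality_chainObjective hτ hα hγ hρ hD2 hab hz h T
    set q : ℝ := (τ : ℝ) / √(N : ℝ) * (4 / √(β / α)) with hq
    have hτN : (τ : ℝ) / N * (1 - ρ ^ 2) ≤ 1 := by
      have h1 : (τ : ℝ) / N ≤ 1 := div_le_one_of_le₀ (by exact_mod_cast hτ) hN.le
      have h2 : (0 : ℝ) ≤ τ / N := by positivity
      nlinarith [sq_nonneg ρ]
    have hmin : (1 - min q 1) ^ T ≤ (1 - τ / N * (1 - ρ ^ 2)) ^ T :=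
      pow_le_pow_left₀ (sub_nonneg.2 (min_le_right q 1))
        (sub_le_sub_left (le_min hrate hτN) 1) T
    have hmain := (ENNReal.ofReal_le_ofReal hmin).trans hbound
    refine ⟨(ENNReal.ofReal_le_ofReal ?_).trans hmain, fun hlarge ε hε _ hle => ?_⟩
    · have := pow_nonneg (sub_nonneg.2 (min_le_right q 1)) T
      linarith
    · have hτ0 : (0 : ℝ) < τ := by exact_mod_cast (by omega : 0 < τ)
      have hsN : 0 < √(N : ℝ) := Real.sqrt_pos.2 hN
      have hsκ : 0 < √(β / α) := Real.sqrt_pos.2 (div_pos (by linarith) hα)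
      have hqe : q = 4 * τ / (√(N : ℝ) * √(β / α)) := by rw [hq]; field_simp
      have hq2 : q ≤ 1 / 2 := by
        rw [hqe, div_le_iff₀ (by positivity)]
        linarith
      have hpow := (ENNReal.ofReal_le_ofReal_iff hε.le).1 (hmain.trans hle)
      rw [min_eq_left (by linarith)] at hpow
      have hlog := log_le_of_one_sub_pow_le hq2 (by positivity) hpow
      have hpos : 0 ≤ √(N : ℝ) / τ * √(β / α) := by positivity
      have he : √(N : ℝ) / τ * √(β / α) * (2 * q * T) = 8 * T := by rw [hqe]; field_simp; ring
      have := mul_le_mul_of_nonneg_left hlog hpos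
      linarith
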